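/- Let $(K,v)$ be a valued field with valuation ring $\mathcal O_v$. An $\mathcal O_v$-ideal is a nonzero $\mathcal O_v$-submodule $I\subsetneq K$ (so fractional ideals are included). More generally, for a subring $\mathcal O$ of $K$ containing $\mathcal O_v$, an $\mathcal O$-ideal is a nonzero $\mathcal O$-submodule of $K$ different from $K$; it is principal if it equals $b\mathcal O$ for some $b\in K$. For an $\mathcal O_v$-ideal $I$ put $$\mathcal O(I)=\{b\in K\mid bI\subseteq I\},\qquad \mathcal M(I)=\{b\in K\mid bI\subsetneq I\},$$ where $\mathcal O(I)$ is a valuation ring of $K$ containing $\mathcal O_v$; and for $\mathcal O_v$-ideals $I,I'$ put $I':I=\{b\in K\mid bI\subseteq I'\}$. "Largest" refers to inclusion. Theorem. Let $I_1,I_2$ be $\mathcal O_v$-ideals. i) Assume that $\mathcal O(I_2)\subsetneq\mathcal O(I_1)$. Then there exists $a\in I_2$ such that $I_2':=a\mathcal M(I_1)\subsetneq I_2$ and $I_2'$ is the largest $\mathcal O(I_1)$-ideal contained in $I_2$. ii) Assume that $\mathcal O(I_1)=\mathcal O(I_2)$, that $I_1$ is a nonprincipal $\mathcal O(I_1)$-ideal,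 and that $I_2$ is a principal $\mathcal O(I_1)$-ideal, say $I_2=a\mathcal O(I_1)$ with $a\in K$. Then $I_2':=a\mathcal M(I_1)\subsetneq I_2$ and $I_2'$ is the largest nonprincipal $\mathcal O(I_1)$-ideal contained in $I_2$. In both cases, $J=I_2':I_1$ is the largest $\mathcal O_v$-ideal $J$ with $I_1J=I_2'$, and $I_2':I_1=I_2:I_1$. -/

import Mathlib

open scoped Pointwise

namespace ValIdeal

variable {K : Type*} [Field K] {Γ₀ : Type*} [LinearOrderedCommGroupWithZero Γ₀]
  {v : Valuation K Γ₀}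

/-- For an overring `O` of the valuation ring `O_v`, an `O_v`-submodule `J` of `K` is an
`O`-ideal if it is nonzero, properly contained in `K`, and closed under multiplication by `O`.
For `O = O_v` the last condition is automatic; fractional ideals are included. -/
structure IsIdealOver (O : ValuationSubring K) (J : Submodule v.valuationSubring K) : Prop where
  ne_bot : J ≠ ⊥
  ne_top : J ≠ ⊤
  mul_mem : ∀ b ∈ O, ∀ x ∈ J, b * x ∈ J

/-- `J = a O` for some `a` in `K`. -/
def IsPrincipalOver (O : ValuationSubring K) (J : Submodule v.valuationSubring K) : Prop :=
  ∃ a : K, (J : Set K) = a • (O : Set K)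

theorem smul_le_iff (b : K) (I J : Submodule v.valuationSubring K) :
    b • I ≤ J ↔ ∀ x ∈ I, b * x ∈ J := by
  constructor
  · intro h x hx
    exact h (Submodule.smul_mem_pointwise_smul x b I hx)
  · intro h y hy
    obtain ⟨x, hx, rfl⟩ := (Submodule.mem_smul_pointwise_iff_exists y b I).1 hy
    exact h x hx

theorem integer_mul_mem {c : K} (hc : v c ≤ 1) {I : Submodule v.valuationSubring K}
    {x : K} (hx : x ∈ I) : c * x ∈ I :=
  I.smul_mem (⟨c, hc⟩ : v.valuationSubring) hx

/-- The invariance valuation ring `O(I) = {b ∈ K | b I ⊆ I}`. -/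
def invRing (I : Submodule v.valuationSubring K) : ValuationSubring K where
  carrier := {b | b • I ≤ I}
  mul_mem' := by
    intro a b ha hb
    simp only [Set.mem_ofPred_eq, smul_le_iff] at *
    intro x hx
    rw [mul_assoc]
    exact ha _ (hb _ hx)
  one_mem' := by simp
  add_mem' := by
    intro a b ha hb
    simp only [Set.mem_ofPred_eq, smul_le_iff] at *
    intro x hx
    rw [add_mul]
    exact I.add_mem (ha _ hx) (hb _ hx)
  zero_mem' := by
    simp only [Set.mem_ofPred_eq, smul_le_iff]
    intro x _
    simp
  neg_mem' := by
    intro a ha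
    simp only [Set.mem_ofPred_eq, smul_le_iff] at *
    intro x hx
    rw [neg_mul]
    exact I.neg_mem (ha _ hx)
  mem_or_inv_mem' := by
    intro a
    simp only [Set.mem_ofPred_eq, smul_le_iff]
    rcases v.valuationSubring.mem_or_inv_mem a with h | h
    · exact Or.inl fun x hx => integer_mul_mem h hx
    · exact Or.inr fun x hx => integer_mul_mem h hx

theorem smul_lt_of_le {a b : K} (h : v a ≤ v b) {I : Submodule v.valuationSubring K}
    (hb : b • I < I) : a • I < I := by
  refine lt_of_le_of_lt ?_ hb
  rw [smul_le_iff]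
  intro x hx
  by_cases hb0 : b = 0
  · have ha0 : a = 0 := by
      apply (map_eq_zero v).1
      rw [hb0, map_zero] at h
      exact le_antisymm h zero_le
    simp [ha0]
  · have hc : v (a / b) ≤ 1 := by
      rw [map_div₀]
      exact div_le_one_of_le₀ h zero_le
    have : a * x = b * (a / b * x) := by field_simp
    rw [this]
    exact Submodule.smul_mem_pointwise_smul _ b I (integer_mul_mem hc hx)

/-- The `O_v`-module `M(I) = {b ∈ K | b I ⊊ I}`, for nonzero `I`. -/
def invMax (I : Submodule v.valuationSubring K) (hI : I ≠ ⊥) :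
    Submodule v.valuationSubring K where
  carrier := {b | b • I < I}
  add_mem' := by
    intro a b ha hb
    rcases le_total (v a) (v b) with h | h
    · exact smul_lt_of_le ((v.map_add a b).trans (max_le h le_rfl)) hb
    · exact smul_lt_of_le ((v.map_add a b).trans (max_le le_rfl h)) ha
  zero_mem' := by
    refine lt_of_le_of_lt ?_ (bot_lt_iff_ne_bot.2 hI)
    rw [smul_le_iff]
    intro x _
    simp
  smul_mem' := by
    intro c b hb
    refine smul_lt_of_le ?_ hb
    change v ((c : K) * b) ≤ v b
    rw [map_mul]
    exact mul_le_of_le_one_left zero_le c.2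

end ValIdeal

/-!
Write `O₁ = O(I₁)`. The key point is that `M(I₁)` is the maximal ideal of `O₁`: a nonzero `b` lies
in `M(I₁)` exactly when `b⁻¹ ∉ O₁` (`ValIdeal.mem_invMax_iff`). Hence `x ∉ a M(I₁)` forces
`a ∈ x O₁`, so that an `O₁`-module not contained in `a M(I₁)` contains `a O₁`
(`ValIdeal.mem_of_not_le`).

In the first case, take `a ∈ I₂` and `c ∈ O₁` with `c a ∉ I₂`; then no `O₁`-ideal inside `I₂` can
contain `a O₁`, while `a M(I₁) ⊆ a O_v ⊆ I₂`. In the second case, an `O₁`-ideal inside `a O₁` that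
is not contained in `a M(I₁)` equals `a O₁`, hence is principal; and `a M(I₁)` itself is nonprincipal
because a principal `M(I₁)` would make `I₁` principal (`ValIdeal.not_isPrincipalOver_smul_invMax`).

The product formula `I₁ (a M(I₁) : I₁) = a M(I₁)` holds for every `a`: given a nonzero
`m ∈ M(I₁)`, any `y ∈ I₁ \ m I₁` satisfies `m / y ∈ M(I₁) : I₁`, so `m = y (m / y)`
(`ValIdeal.mul_smul_invMax_div`). Finally, for `b ≠ 0` with `b I₁ ⊆ I₂`, the module `b I₁` is an
`O₁`-ideal inside `I₂`, nonprincipal if `I₁` is, so the maximality of `a M(I₁)` gives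
`I₂ : I₁ = a M(I₁) : I₁`.
-/

namespace ValIdeal

variable {K : Type*} [Field K] {Γ₀ : Type*} [LinearOrderedCommGroupWithZero Γ₀]
  {v : Valuation K Γ₀}

theorem mem_invRing_iff {I : Submodule v.valuationSubring K} {b : K} :
    b ∈ invRing I ↔ ∀ x ∈ I, b * x ∈ I :=
  smul_le_iff b I I

theorem valuationSubring_le_invRing (I : Submodule v.valuationSubring K) :
    v.valuationSubring ≤ invRing I :=
  fun _ hc => mem_invRing_iff.2 fun _ hx => integer_mul_mem hc hx

theorem mem_smul_iff {a : K} (ha : a ≠ 0) {I : Submodule v.valuationSubring K} {x : K} :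
    x ∈ a • I ↔ a⁻¹ * x ∈ I := by
  rw [Submodule.mem_smul_pointwise_iff_exists]
  constructor
  · rintro ⟨y, hy, rfl⟩
    simpa [ha] using hy
  · intro h
    exact ⟨_, h, by simp [ha]⟩

/-- `M(I)` consists of the nonunits of the valuation ring `O(I)`. -/
theorem mem_invMax_iff {I : Submodule v.valuationSubring K} {hI : I ≠ ⊥} {b : K} :
    b ∈ invMax I hI ↔ b = 0 ∨ b⁻¹ ∉ invRing I := by
  change b • I < I ↔ _
  constructor
  · intro h
    refine or_iff_not_imp_left.2 fun hb hinv => h.not_ge fun x hx => ?_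
    exact (mem_smul_iff hb).2 (mem_invRing_iff.1 hinv x hx)
  · intro h
    by_cases hb : b = 0
    · subst hb
      exact (invMax I hI).zero_mem
    · have hinv := h.resolve_left hb
      refine lt_of_le_not_ge (((invRing I).mem_or_inv_mem b).resolve_right hinv) fun hle => hinv ?_
      exact mem_invRing_iff.2 fun x hx => (mem_smul_iff hb).1 (hle hx)

theorem one_notMem_invMax {I : Submodule v.valuationSubring K} (hI : I ≠ ⊥) :
    (1 : K) ∉ invMax I hI := by
  simp [mem_invMax_iff, (invRing I).one_mem]

theorem invMax_subset_valuationSubring {I : Submodule v.valuationSubring K} {hI : I ≠ ⊥} {b : K}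
    (hb : b ∈ invMax I hI) : b ∈ v.valuationSubring := by
  rcases mem_invMax_iff.1 hb with rfl | h
  · exact zero_mem _
  · exact (v.valuationSubring.mem_or_inv_mem b).resolve_right
      fun h' => h (valuationSubring_le_invRing I h')

theorem mul_mem_invMax {I : Submodule v.valuationSubring K} {hI : I ≠ ⊥} {b c : K}
    (hc : c ∈ invRing I) (hb : b ∈ invMax I hI) : c * b ∈ invMax I hI := by
  rw [mem_invMax_iff] at hb ⊢
  by_cases hc0 : c = 0
  · simp [hc0]
  refine hb.imp (by simp +contextual) fun h h' => h ?_
  have := mul_mem hc h'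
  rwa [mul_inv, mul_inv_cancel_left₀ hc0] at this

/-- Otherwise `O(I) = K`, and `I` would be a nonzero `K`-subspace of `K`. -/
theorem invMax_ne_bot {I : Submodule v.valuationSubring K} (hI : I ≠ ⊥) (hI' : I ≠ ⊤) :
    invMax I hI ≠ ⊥ := by
  intro h
  obtain ⟨y, hy, hy0⟩ := Submodule.exists_mem_ne_zero_of_ne_bot hI
  refine hI' (eq_top_iff.2 fun z _ => ?_)
  have hmem : z * y⁻¹ ∈ invRing I := by
    by_contra hn
    have : (z * y⁻¹)⁻¹ ∈ invMax I hI := mem_invMax_iff.2 (Or.inr (by rwa [inv_inv]))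
    rw [h, Submodule.mem_bot, inv_eq_zero] at this
    exact hn (this ▸ zero_mem _)
  simpa [hy0] using mem_invRing_iff.1 hmem y hy

theorem smul_ne_bot {a : K} (ha : a ≠ 0) {I : Submodule v.valuationSubring K} (hI : I ≠ ⊥) :
    a • I ≠ ⊥ := by
  obtain ⟨y, hy, hy0⟩ := Submodule.exists_mem_ne_zero_of_ne_bot hI
  intro h
  have := Submodule.smul_mem_pointwise_smul y a I hy
  rw [h, Submodule.mem_bot] at this
  exact mul_ne_zero ha hy0 this

theorem IsIdealOver.smul {O : ValuationSubring K} {I : Submodule v.valuationSubring K}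
    (hI : IsIdealOver O I) {a : K} (ha : a ≠ 0) : IsIdealOver O (a • I) where
  ne_bot := smul_ne_bot ha hI.ne_bot
  ne_top h := hI.ne_top <| eq_top_iff.2 fun z _ => by
    have : a * z ∈ a • I := h ▸ Submodule.mem_top
    simpa [ha] using (mem_smul_iff ha).1 this
  mul_mem b hb x hx := by
    rw [mem_smul_iff ha] at hx ⊢
    rw [mul_left_comm]
    exact hI.mul_mem b hb _ hx

theorem IsIdealOver.invRing {I : Submodule v.valuationSubring K}
    (hI : IsIdealOver v.valuationSubring I) : IsIdealOver (invRing I) I :=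
  ⟨hI.ne_bot, hI.ne_top, fun _ hb => mem_invRing_iff.1 hb⟩

theorem isIdealOver_invMax {I : Submodule v.valuationSubring K}
    (hI : IsIdealOver v.valuationSubring I) : IsIdealOver (invRing I) (invMax I hI.ne_bot) where
  ne_bot := invMax_ne_bot hI.ne_bot hI.ne_top
  ne_top h := one_notMem_invMax hI.ne_bot (h ▸ Submodule.mem_top)
  mul_mem _ hb _ hx := mul_mem_invMax hb hx

theorem notMem_smul_invMax {I : Submodule v.valuationSubring K} (hI : I ≠ ⊥) {a : K}
    (ha : a ≠ 0) : a ∉ a • invMax I hI := by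
  rw [mem_smul_iff ha, inv_mul_cancel₀ ha]
  exact one_notMem_invMax hI

/-- An `O(I)`-module not contained in `a M(I)` contains `a`, because `O(I)`-modules are linearly
ordered and `a M(I)` is the largest one below `a O(I)`. -/
theorem mem_of_not_le {I J : Submodule v.valuationSubring K} {hI : I ≠ ⊥} {a : K} (ha : a ≠ 0)
    (hJ : IsIdealOver (invRing I) J) (h : ¬ J ≤ a • invMax I hI) : a ∈ J := by
  obtain ⟨x, hx, hxa⟩ := SetLike.not_le_iff_exists.1 h
  rw [mem_smul_iff ha, mem_invMax_iff, not_or, not_not] at hxa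
  have hx0 : x ≠ 0 := fun h0 => hxa.1 (by simp [h0])
  have := hJ.mul_mem _ hxa.2 x hx
  rwa [mul_inv, inv_inv, mul_assoc, inv_mul_cancel₀ hx0, mul_one] at this

theorem isPrincipalOver_of_smul {O : ValuationSubring K} {I : Submodule v.valuationSubring K}
    {a : K} (ha : a ≠ 0) (h : IsPrincipalOver O (a • I)) : IsPrincipalOver O I := by
  obtain ⟨b, hb⟩ := h
  refine ⟨a⁻¹ * b, ?_⟩
  rw [mul_smul, ← hb, Submodule.coe_pointwise_smul, inv_smul_smul₀ ha]

/-- If `M(I) = b O(I)`, then any `x ∈ I` with `b⁻¹ x ∉ I` generates `I` over `O(I)`. -/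
theorem isPrincipalOver_of_invMax {I : Submodule v.valuationSubring K}
    (hI : IsIdealOver v.valuationSubring I)
    (h : IsPrincipalOver (invRing I) (invMax I hI.ne_bot)) : IsPrincipalOver (invRing I) I := by
  obtain ⟨b, hb⟩ := h
  have hb0 : b ≠ 0 := by
    rintro rfl
    refine invMax_ne_bot hI.ne_bot hI.ne_top (eq_bot_iff.2 fun x hx => ?_)
    rw [← SetLike.mem_coe, hb] at hx
    obtain ⟨y, -, rfl⟩ := hx
    simp
  have hbM : b ∈ invMax I hI.ne_bot := by
    rw [← SetLike.mem_coe, hb]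
    exact ⟨1, (invRing I).one_mem, by simp⟩
  have hbinv := (mem_invMax_iff.1 hbM).resolve_left hb0
  rw [mem_invRing_iff] at hbinv
  push Not at hbinv
  obtain ⟨x, hx, hbx⟩ := hbinv
  have hx0 : x ≠ 0 := by
    rintro rfl
    exact hbx (by simp)
  refine ⟨x, Set.ext fun y => ⟨fun hy => ⟨x⁻¹ * y, ?_, by simp [hx0]⟩, ?_⟩⟩
  · by_contra hn
    have hM : y⁻¹ * x ∈ invMax I hI.ne_bot :=
      mem_invMax_iff.2 (Or.inr (by rwa [mul_inv, inv_inv, mul_comm]))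
    have hy0 : y ≠ 0 := by
      rintro rfl
      exact hn (by simp)
    rw [← SetLike.mem_coe, hb] at hM
    obtain ⟨c, hc, hcx⟩ := hM
    have hcx : b * c = y⁻¹ * x := hcx
    refine hbx ?_
    have : b⁻¹ * x = c * y := by
      field_simp
      field_simp at hcx
      linear_combination -hcx
    rw [this]
    exact mem_invRing_iff.1 hc y hy
  · rintro ⟨c, hc, rfl⟩
    change x * c ∈ I
    rw [mul_comm]
    exact mem_invRing_iff.1 hc x hx

theorem not_isPrincipalOver_smul_invMax {I : Submodule v.valuationSubring K}
    (hI : IsIdealOver v.valuationSubring I) (hnp : ¬ IsPrincipalOver (invRing I) I) {a : K}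
    (ha : a ≠ 0) : ¬ IsPrincipalOver (invRing I) (a • invMax I hI.ne_bot) :=
  fun h => hnp (isPrincipalOver_of_invMax hI (isPrincipalOver_of_smul ha h))

theorem mul_smul_invMax_div {I : Submodule v.valuationSubring K} (hI : I ≠ ⊥) {a : K}
    (ha : a ≠ 0) : I * (a • invMax I hI / I) = a • invMax I hI := by
  refine le_antisymm (Submodule.mul_le.2 fun m hm n hn => ?_) fun z hz => ?_
  · rw [mul_comm]
    exact Submodule.mem_div_iff_forall_mul_mem.1 hn m hm
  · obtain ⟨m, hm, rfl⟩ := (Submodule.mem_smul_pointwise_iff_exists _ _ _).1 hz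
    by_cases hm0 : m = 0
    · simp [hm0]
    have hminv := (mem_invMax_iff.1 hm).resolve_left hm0
    rw [mem_invRing_iff] at hminv
    push Not at hminv
    obtain ⟨y, hy, hmy⟩ := hminv
    have hy0 : y ≠ 0 := by
      rintro rfl
      exact hmy (by simp)
    have heq : a • m = y * (a * (m * y⁻¹)) := by
      rw [smul_eq_mul]
      field_simp
    rw [heq]
    refine Submodule.mul_mem_mul hy (Submodule.mem_div_iff_forall_mul_mem.2 fun x hx => ?_)
    rw [mem_smul_iff ha, mul_assoc, inv_mul_cancel_left₀ ha, mem_invMax_iff]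
    by_cases hx0 : x = 0
    · simp [hx0]
    refine Or.inr fun h => hmy ?_
    have := mem_invRing_iff.1 h x hx
    rwa [mul_inv, mul_inv, inv_inv, inv_mul_cancel_right₀ hx0] at this

theorem isGreatest_smul_invMax_div {I : Submodule v.valuationSubring K}
    (hI : IsIdealOver v.valuationSubring I) {a : K} (ha : a ≠ 0) :
    IsGreatest {J | IsIdealOver v.valuationSubring J ∧ I * J = a • invMax I hI.ne_bot}
      (a • invMax I hI.ne_bot / I) := by
  have hmul := mul_smul_invMax_div hI.ne_bot ha
  refine ⟨⟨⟨fun h => ?_, fun h => ?_, fun b hb x hx => integer_mul_mem hb hx⟩, hmul⟩, ?_⟩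
  · rw [h, Submodule.mul_bot] at hmul
    exact smul_ne_bot ha (invMax_ne_bot hI.ne_bot hI.ne_top) hmul.symm
  · obtain ⟨y, hy, hy0⟩ := Submodule.exists_mem_ne_zero_of_ne_bot hI.ne_bot
    have hay : a * y⁻¹ ∈ a • invMax I hI.ne_bot / I := h ▸ Submodule.mem_top
    have := Submodule.mem_div_iff_forall_mul_mem.1 hay y hy
    rw [inv_mul_cancel_right₀ hy0] at this
    exact notMem_smul_invMax hI.ne_bot ha this
  · rintro J ⟨-, hJ⟩
    rw [Submodule.le_div_iff_mul_le, mul_comm, hJ]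

/-- The quotient by `I` only sees those `b I` with `b ≠ 0` that are contained in the numerator. -/
theorem div_eq_div_of_smul_le {I I' J : Submodule v.valuationSubring K} (hle : I' ≤ J)
    (h : ∀ b : K, b ≠ 0 → b • I ≤ J → b • I ≤ I') : I' / I = J / I := by
  refine le_antisymm (fun b hb => ?_) fun b hb => ?_
  · rw [Submodule.mem_div_iff_forall_mul_mem] at hb ⊢
    exact fun y hy => hle (hb y hy)
  · by_cases hb0 : b = 0
    · simp [hb0]
    rw [Submodule.mem_div_iff_forall_mul_mem] at hb ⊢
    exact (smul_le_iff b I I').1 (h b hb0 ((smul_le_iff b I J).2 hb))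

end ValIdeal

open ValIdeal in
theorem theorem3p18 {K : Type*} [Field K] {Γ₀ : Type*} [LinearOrderedCommGroupWithZero Γ₀]
    (v : Valuation K Γ₀) (I₁ I₂ : Submodule v.valuationSubring K)
    (h₁ : IsIdealOver v.valuationSubring I₁) (h₂ : IsIdealOver v.valuationSubring I₂) :
    (invRing I₂ < invRing I₁ →
      ∃ a ∈ I₂, ∃ I₂' : Submodule v.valuationSubring K,
        I₂' = a • invMax I₁ h₁.ne_bot ∧
        I₂' < I₂ ∧
        IsGreatest {J | IsIdealOver (invRing I₁) J ∧ J ≤ I₂} I₂' ∧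
        IsGreatest {J | IsIdealOver v.valuationSubring J ∧ I₁ * J = I₂'} (I₂' / I₁) ∧
        I₂' / I₁ = I₂ / I₁) ∧
    (invRing I₁ = invRing I₂ → ¬ IsPrincipalOver (invRing I₁) I₁ →
      ∀ a : K, (I₂ : Set K) = a • (invRing I₁ : Set K) →
        ∃ I₂' : Submodule v.valuationSubring K,
          I₂' = a • invMax I₁ h₁.ne_bot ∧
          I₂' < I₂ ∧
          IsGreatest {J | (IsIdealOver (invRing I₁) J ∧ ¬ IsPrincipalOver (invRing I₁) J) ∧
            J ≤ I₂} I₂' ∧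
          IsGreatest {J | IsIdealOver v.valuationSubring J ∧ I₁ * J = I₂'} (I₂' / I₁) ∧
          I₂' / I₁ = I₂ / I₁) := by
  -- Both cases pick `a ∈ I₂`, and `M(I₁) ⊆ O_v` then gives `a M(I₁) ⊆ I₂`.
  have hlt : ∀ a ∈ I₂, a ≠ 0 → a • invMax I₁ h₁.ne_bot < I₂ := fun a ha ha0 =>
    lt_of_le_not_ge ((smul_le_iff _ _ _).2 fun m hm => by
      rw [mul_comm]
      exact integer_mul_mem (invMax_subset_valuationSubring hm) ha)
      fun h => notMem_smul_invMax h₁.ne_bot ha0 (h ha)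
  constructor
  · intro h
    obtain ⟨c, hc, hc₂⟩ := SetLike.exists_of_lt h
    rw [mem_invRing_iff] at hc₂
    push Not at hc₂
    obtain ⟨a, ha, hca⟩ := hc₂
    have ha0 : a ≠ 0 := by
      rintro rfl
      exact hca (by simp)
    have hmax : ∀ J, IsIdealOver (invRing I₁) J → J ≤ I₂ → J ≤ a • invMax I₁ h₁.ne_bot := by
      intro J hJ hJ₂
      by_contra hn
      exact hca (hJ₂ (hJ.mul_mem c hc a (mem_of_not_le ha0 hJ hn)))
    refine ⟨a, ha, _, rfl, hlt a ha ha0,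
      ⟨⟨(isIdealOver_invMax h₁).smul ha0, (hlt a ha ha0).le⟩, fun J hJ => hmax J hJ.1 hJ.2⟩,
      isGreatest_smul_invMax_div h₁ ha0,
      div_eq_div_of_smul_le (hlt a ha ha0).le fun b hb hle => hmax _ (h₁.invRing.smul hb) hle⟩
  · intro _ hnp a haI
    have ha : a ∈ I₂ := by
      rw [← SetLike.mem_coe, haI]
      exact ⟨1, (invRing I₁).one_mem, by simp⟩
    have ha0 : a ≠ 0 := by
      rintro rfl
      refine h₂.ne_bot (eq_bot_iff.2 fun x hx => ?_)
      rw [← SetLike.mem_coe, haI] at hx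
      obtain ⟨y, -, rfl⟩ := hx
      simp
    have hmax : ∀ J, IsIdealOver (invRing I₁) J → ¬ IsPrincipalOver (invRing I₁) J → J ≤ I₂ →
        J ≤ a • invMax I₁ h₁.ne_bot := by
      intro J hJ hJnp hJ₂
      by_contra hn
      have haJ := mem_of_not_le ha0 hJ hn
      refine hJnp ⟨a, Set.Subset.antisymm (fun x hx => haI ▸ hJ₂ hx) ?_⟩
      rintro _ ⟨c, hc, rfl⟩
      change a * c ∈ J
      rw [mul_comm]
      exact hJ.mul_mem c hc a haJ
    refine ⟨_, rfl, hlt a ha ha0,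
      ⟨⟨⟨(isIdealOver_invMax h₁).smul ha0, not_isPrincipalOver_smul_invMax h₁ hnp ha0⟩,
        (hlt a ha ha0).le⟩, fun J hJ => hmax J hJ.1.1 hJ.1.2 hJ.2⟩,
      isGreatest_smul_invMax_div h₁ ha0,
      div_eq_div_of_smul_le (hlt a ha ha0).le fun b hb hle =>
        hmax _ (h₁.invRing.smul hb) (fun hp => hnp (isPrincipalOver_of_smul hb hp)) hle⟩
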